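/- Let $L_p$ be the space of real $2\pi$-periodic functions with norm $\|\varphi\|_p=\big(\int_0^{2\pi}|\varphi(t)|^p\,dt\big)^{1/p}$ and let $\|f\|_C=\max_t|f(t)|$ for continuous $2\pi$-periodic $f$. For $\alpha>0$, $0<r<1$, $\beta\in\mathbb{R}$ let $C^{\alpha,r}_{\beta,2}$ be the set of all $2\pi$-periodic functions $f$ that can be represented, for all $x\in\mathbb{R}$, in the form $$f(x)=\frac{a_0}{2}+\frac1\pi\int_{-\pi}^{\pi}P_{\alpha,r,\beta}(x-t)\varphi(t)\,dt,\qquad P_{\alpha,r,\beta}(t)=\sum_{k=1}^{\infty}e^{-\alpha k^r}\cos\Big(kt-\frac{\beta\pi}{2}\Big),$$ with $a_0\in\mathbb{R}$, $\varphi\in L_2$, $\|\varphi\|_2\le1$ and $\int_{-\pi}^{\pi}\varphi(t)\,dt=0$. Let $$\mathcal{E}_n(C^{\alpha,r}_{\beta,2})_C=\sup_{f\in C^{\alpha,r}_{\beta,2}}\|f-S_{n-1}(f)\|_C,$$ where $S_{n-1}(f)$ is the partial Fourier sum of $f$ of order $n-1$, and let $n_0(\alpha,r,2)$ be the smallest positive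 integer $n$ such that $$\frac{1}{\alpha r}\frac{1}{n^r}+\frac{2\alpha r}{n^{1-r}}\le\frac{1}{2(3\pi)^3}.$$ **Corollary 1.** Let $0<r<1$, $\alpha>0$ and $\beta\in\mathbb{R}$. Then for every integer $n\ge n_0(\alpha,r,2)$ $$\mathcal{E}_n(C^{\alpha,r}_{\beta,2})_C=\frac{e^{-\alpha n^r}}{\sqrt{2\pi\alpha r}}\,n^{\frac{1-r}{2}}\bigg(1+\gamma_n\Big(\frac{1}{\alpha r}\frac{1}{n^r}+\frac{\sqrt{\alpha r}}{n^{\frac{1-r}{2}}}\Big)\bigg),$$ where the quantity $\gamma_n=\gamma_n(\alpha,r,\beta)$ satisfies $|\gamma_n|\le392\,\pi^{5/2}$. -/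

import Mathlib

namespace GenPoisson

open Real MeasureTheory

noncomputable section

/-- The generalized Poisson kernel
`P_{α,r,β}(t) = ∑_{k ≥ 1} exp (-α k ^ r) cos (k t - β π / 2)`. -/
def kernel (α r β t : ℝ) : ℝ :=
  ∑' k : ℕ, exp (-α * ((k + 1 : ℕ) : ℝ) ^ r) * cos (((k + 1 : ℕ) : ℝ) * t - β * π / 2)

/-- The set `B_p^0` of real `2π`-periodic functions `φ ∈ L_p` with `‖φ‖_p ≤ 1` and `φ ⊥ 1`, where
`‖·‖_p` is the (unnormalized) `L_p` norm over one period. -/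
def unitBall (p : ENNReal) : Set (ℝ → ℝ) :=
  {φ | Function.Periodic φ (2 * π) ∧
    MemLp φ p (volume.restrict (Set.Ioc (-π) π)) ∧
    eLpNorm φ p (volume.restrict (Set.Ioc (-π) π)) ≤ 1 ∧
    ∫ t in (-π)..π, φ t = 0}

/-- The class `C^{α,r}_{β,p}` of generalized Poisson integrals. -/
def poissonClass (α r β : ℝ) (p : ENNReal) : Set (ℝ → ℝ) :=
  {f | Function.Periodic f (2 * π) ∧ ∃ a₀ : ℝ, ∃ φ ∈ unitBall p, ∀ x : ℝ,
    f x = a₀ / 2 + 1 / π * ∫ t in (-π)..π, kernel α r β (x - t) * φ t}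

/-- The cosine Fourier coefficient `a_k(f)`. -/
def cosCoeff (f : ℝ → ℝ) (k : ℕ) : ℝ := 1 / π * ∫ t in (-π)..π, f t * cos (k * t)

/-- The sine Fourier coefficient `b_k(f)`. -/
def sinCoeff (f : ℝ → ℝ) (k : ℕ) : ℝ := 1 / π * ∫ t in (-π)..π, f t * sin (k * t)

/-- The partial Fourier sum `S_m(f; x)` of order `m`. -/
def fourierSum (f : ℝ → ℝ) (m : ℕ) (x : ℝ) : ℝ :=
  cosCoeff f 0 / 2 +
    ∑ k ∈ Finset.Icc 1 m, (cosCoeff f k * cos (k * x) + sinCoeff f k * sin (k * x))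

/-- The uniform norm `‖g‖_C = sup_x |g x|`, with values in the extended reals. -/
def uniformNorm (g : ℝ → ℝ) : EReal := ⨆ x : ℝ, ((|g x| : ℝ) : EReal)

/-- The quantity `𝓔_n(C^{α,r}_{β,p})_C = sup_f ‖f - S_{n-1}(f)‖_C`, for `n ≥ 1`, with values in the
extended reals (so that no boundedness is presupposed). -/
def fourierError (α r β : ℝ) (p : ENNReal) (n : ℕ) : EReal :=
  ⨆ f ∈ poissonClass α r β p, uniformNorm (fun x => f x - fourierSum f (n - 1) x)

/-- `χ(p) = p` for finite `p`, and `χ(∞) = 1`. -/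
def chi (p : ENNReal) : ℝ := if p = ⊤ then 1 else p.toReal

/-- The right-hand side of the inequality that defines `n₀(α, r, p)`. -/
def thresholdBound (p : ENNReal) : ℝ :=
  if p = 1 then 1 / 14
  else if p = ⊤ then 1 / (3 * π) ^ 3
  else 1 / (3 * π) ^ 3 * ((p.toReal - 1) / p.toReal)

/-- The positive integers `n` with `1 / (α r n ^ r) + α r χ(p) / n ^ (1 - r) ≤ thresholdBound p`. -/
def thresholdSet (α r : ℝ) (p : ENNReal) : Set ℕ :=
  {n | 1 ≤ n ∧
    1 / (α * r) * (1 / (n : ℝ) ^ r) + α * r * chi p / (n : ℝ) ^ (1 - r) ≤ thresholdBound p}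

/-- The number `n₀(α, r, p)`: the least element of `thresholdSet α r p`. -/
def n₀ (α r : ℝ) (p : ENNReal) : ℕ := sInf (thresholdSet α r p)

/-- `n₀` really is a least element: the set in its definition is not empty. -/
theorem isLeast_n₀ {α r : ℝ} {p : ENNReal} (hr0 : 0 < r) (hr1 : r < 1)
    (hp : 1 ≤ p) : IsLeast (thresholdSet α r p) (n₀ α r p) := by
  have hb : 0 < thresholdBound p := by
    unfold thresholdBound
    split_ifs with h1 h2
    · norm_num
    · positivity
    · have : 1 < p.toReal := by
        have h : (1 : ENNReal) < p := lt_of_le_of_ne hp (Ne.symm h1)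
        simpa using (ENNReal.toReal_lt_toReal (by simp) h2).2 h
      have h' : 0 < p.toReal - 1 := by linarith
      positivity
  have hne : (thresholdSet α r p).Nonempty := by
    have h1 : Filter.Tendsto (fun n : ℕ => 1 / (α * r) * (1 / (n : ℝ) ^ r)
        + α * r * chi p / (n : ℝ) ^ (1 - r)) Filter.atTop (nhds (1 / (α * r) * 0 + 0)) := by
      refine Filter.Tendsto.add (Filter.Tendsto.const_mul _ ?_) ?_
      · exact Filter.Tendsto.const_div_atTop
          ((tendsto_rpow_atTop hr0).comp tendsto_natCast_atTop_atTop) _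
      · exact Filter.Tendsto.const_div_atTop
          ((tendsto_rpow_atTop (by linarith : 0 < 1 - r)).comp tendsto_natCast_atTop_atTop) _
    rw [mul_zero, add_zero] at h1
    obtain ⟨n, hn, hn'⟩ :=
      ((h1.eventually (ge_mem_nhds hb)).and (Filter.eventually_ge_atTop 1)).exists
    exact ⟨n, hn', hn⟩
  exact ⟨Nat.sInf_mem hne, fun m hm => Nat.sInf_le hm⟩

end

end GenPoisson

/-! For `p = 2` the error has a closed form. The deviation `f - S_{n-1}(f)` is `1 / π` times the
convolution of `φ` with the tail `T` of the kernel (`sub_fourierSum_eq`). Cauchy–Schwarz bounds it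
by `‖T‖₂ / π`, and since `T` has mean zero, the reflected and normalized `T` is itself admissible
and attains the bound. Parseval gives `‖T‖₂² = π ∑_{k ≥ n} exp (-2α k ^ r)`, so `β` disappears
(`fourierError_two_eq`).

It remains to estimate this sum. With `a = 2α`, `tailMain a r` is almost an antiderivative of `-exp
(-a t ^ r)`: the relative error is at most `1 / (a r t ^ r)`. Telescoping encloses the sum between
`tailMain` at `n` and a slight multiple of it plus the first term, whose ratio to `tailMain` is `2αr
/ n ^ (1 - r)`. Taking square roots (`exists_sqrt_tsum_eq`) yields `0 ≤ γ ≤ 1`, well inside the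
required bound. -/

namespace GenPoisson

open Real MeasureTheory Filter Topology

/-! ### Orthogonality of the trigonometric system. -/

theorem integral_cos_int_mul (m : ℤ) :
    ∫ t in (-π)..π, cos (m * t) = if m = 0 then 2 * π else 0 := by
  split_ifs with h
  · simp [h]; ring
  · have hm : (m : ℝ) ≠ 0 := by exact_mod_cast h
    rw [intervalIntegral.integral_comp_mul_left (fun t => cos t) hm, integral_cos,
      mul_neg, sin_neg, sin_int_mul_pi]
    simp

theorem integral_sin_int_mul (m : ℤ) : ∫ t in (-π)..π, sin (m * t) = 0 := by
  rcases eq_or_ne m 0 with h | h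
  · simp [h]
  · have hm : (m : ℝ) ≠ 0 := by exact_mod_cast h
    rw [intervalIntegral.integral_comp_mul_left (fun t => sin t) hm, integral_sin,
      mul_neg, cos_neg]
    simp

theorem integral_cos_mul_cos (j k : ℕ) :
    ∫ t in (-π)..π, cos (j * t) * cos (k * t) =
      if j = k then (if k = 0 then 2 * π else π) else 0 := by
  have h : ∀ t : ℝ, cos (j * t) * cos (k * t) =
      2⁻¹ * (cos (((j - k : ℤ) : ℝ) * t) + cos (((j + k : ℤ) : ℝ) * t)) := fun t => by
    push_cast; rw [sub_mul, add_mul, cos_sub, cos_add]; ring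
  simp_rw [h]
  rw [intervalIntegral.integral_const_mul, intervalIntegral.integral_add
    (by apply Continuous.intervalIntegrable; fun_prop)
    (by apply Continuous.intervalIntegrable; fun_prop),
    integral_cos_int_mul, integral_cos_int_mul]
  have e1 : ((j : ℤ) - k = 0) ↔ j = k := by omega
  have e2 : ((j : ℤ) + k = 0) ↔ j = 0 ∧ k = 0 := by omega
  simp only [e1, e2]
  by_cases hjk : j = k
  · subst hjk
    by_cases hj : j = 0
    · simp [hj]; ring
    · simp [hj]
  · have : ¬(j = 0 ∧ k = 0) := by omega
    simp [hjk, this]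

theorem integral_sin_mul_sin (j k : ℕ) :
    ∫ t in (-π)..π, sin (j * t) * sin (k * t) =
      if j = k then (if k = 0 then 0 else π) else 0 := by
  have h : ∀ t : ℝ, sin (j * t) * sin (k * t) =
      2⁻¹ * (cos (((j - k : ℤ) : ℝ) * t) - cos (((j + k : ℤ) : ℝ) * t)) := fun t => by
    push_cast; rw [sub_mul, add_mul, cos_sub, cos_add]; ring
  simp_rw [h]
  rw [intervalIntegral.integral_const_mul, intervalIntegral.integral_sub
    (by apply Continuous.intervalIntegrable; fun_prop)
    (by apply Continuous.intervalIntegrable; fun_prop),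
    integral_cos_int_mul, integral_cos_int_mul]
  have e1 : ((j : ℤ) - k = 0) ↔ j = k := by omega
  have e2 : ((j : ℤ) + k = 0) ↔ j = 0 ∧ k = 0 := by omega
  simp only [e1, e2]
  by_cases hjk : j = k
  · subst hjk
    by_cases hj : j = 0
    · simp [hj]
    · simp [hj]
  · have : ¬(j = 0 ∧ k = 0) := by omega
    simp [hjk, this]

theorem integral_sin_mul_cos (j k : ℕ) :
    ∫ t in (-π)..π, sin (j * t) * cos (k * t) = 0 := by
  have h : ∀ t : ℝ, sin (j * t) * cos (k * t) =
      2⁻¹ * (sin (((j - k : ℤ) : ℝ) * t) + sin (((j + k : ℤ) : ℝ) * t)) := fun t => by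
    push_cast; rw [sub_mul, add_mul, sin_sub, sin_add]; ring
  simp_rw [h]
  rw [intervalIntegral.integral_const_mul, intervalIntegral.integral_add
    (by apply Continuous.intervalIntegrable; fun_prop)
    (by apply Continuous.intervalIntegrable; fun_prop),
    integral_sin_int_mul, integral_sin_int_mul]
  simp

/-! ### Absolutely convergent trigonometric series: coefficients, Fourier sums, Parseval. -/

/-- Termwise integration of a uniformly dominated series against an integrable function. -/
theorem hasSum_intervalIntegral_mul {u : ℕ → ℝ → ℝ} {b : ℕ → ℝ} {φ : ℝ → ℝ}
    (hu : ∀ k, Continuous (u k)) (hub : ∀ k t, |u k t| ≤ b k) (hb : Summable b)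
    (hφ : IntervalIntegrable φ volume (-π) π) :
    HasSum (fun k => ∫ t in (-π)..π, u k t * φ t) (∫ t in (-π)..π, (∑' k, u k t) * φ t) := by
  have hpi : -π ≤ π := by linarith [pi_pos]
  have hb0 : ∀ k, 0 ≤ b k := fun k => (abs_nonneg _).trans (hub k 0)
  have hint : ∀ k, Integrable (fun t => u k t * φ t) (volume.restrict (Set.Ioc (-π) π)) :=
    fun k => ((intervalIntegrable_iff_integrableOn_Ioc_of_le hpi).1 hφ).bdd_mul
      (c := b k) (hu k).aestronglyMeasurable (Eventually.of_forall fun t => hub k t)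
  have h := hasSum_integral_of_summable_integral_norm hint (by
    refine Summable.of_nonneg_of_le (fun k => integral_nonneg fun t => norm_nonneg _) (fun k => ?_)
      (hb.mul_right (∫ t in Set.Ioc (-π) π, ‖φ t‖))
    rw [← integral_const_mul]
    refine integral_mono (hint k).norm
      (((intervalIntegrable_iff_integrableOn_Ioc_of_le hpi).1 hφ).norm.const_mul _) fun t => ?_
    simp only [norm_mul]
    exact mul_le_mul_of_nonneg_right (hub k t) (norm_nonneg _))
  simp only [intervalIntegral.integral_of_le hpi]
  simp_rw [tsum_mul_right] at h
  exact h

/-- The trigonometric series with coefficients `c`, `d`. -/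
noncomputable def trigSeries (c d : ℕ → ℝ) (x : ℝ) : ℝ :=
  ∑' k : ℕ, (c k * cos (k * x) + d k * sin (k * x))

theorem abs_trigTerm_le (c d x y : ℝ) : |c * cos x + d * sin y| ≤ |c| + |d| := by
  refine (abs_add_le _ _).trans (add_le_add ?_ ?_) <;> rw [abs_mul]
  · exact mul_le_of_le_one_right (abs_nonneg _) (abs_cos_le_one _)
  · exact mul_le_of_le_one_right (abs_nonneg _) (abs_sin_le_one _)

theorem summable_trigTerm {c d : ℕ → ℝ} (hc : Summable fun k => |c k|)
    (hd : Summable fun k => |d k|) (x : ℝ) :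
    Summable fun k : ℕ => c k * cos (k * x) + d k * sin (k * x) :=
  Summable.of_norm_bounded (hc.add hd) fun _ => abs_trigTerm_le _ _ _ _

theorem continuous_trigSeries {c d : ℕ → ℝ} (hc : Summable fun k => |c k|)
    (hd : Summable fun k => |d k|) : Continuous (trigSeries c d) :=
  continuous_tsum (fun k => by fun_prop) (hc.add hd) fun k x => abs_trigTerm_le _ _ _ _

theorem hasSum_integral_trigSeries_mul {c d : ℕ → ℝ} (hc : Summable fun k => |c k|)
    (hd : Summable fun k => |d k|) {φ : ℝ → ℝ} (hφ : IntervalIntegrable φ volume (-π) π) :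
    HasSum (fun k : ℕ => ∫ t in (-π)..π, (c k * cos (k * t) + d k * sin (k * t)) * φ t)
      (∫ t in (-π)..π, trigSeries c d t * φ t) :=
  hasSum_intervalIntegral_mul (fun k => by fun_prop) (fun k t => abs_trigTerm_le _ _ _ _)
    (hc.add hd) hφ

theorem integral_trigSeries_mul_cos {c d : ℕ → ℝ} (hc : Summable fun k => |c k|)
    (hd : Summable fun k => |d k|) (j : ℕ) :
    ∫ t in (-π)..π, trigSeries c d t * cos (j * t) = c j * (if j = 0 then 2 * π else π) := by
  rw [← (hasSum_integral_trigSeries_mul hc hd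
    (φ := fun t => cos (j * t)) (by apply Continuous.intervalIntegrable; fun_prop)).tsum_eq]
  have h : ∀ k : ℕ, ∫ t in (-π)..π, (c k * cos (k * t) + d k * sin (k * t)) * cos (j * t) =
      if k = j then c j * (if j = 0 then 2 * π else π) else 0 := fun k => by
    simp_rw [add_mul, mul_assoc]
    rw [intervalIntegral.integral_add
      (by apply Continuous.intervalIntegrable; fun_prop)
      (by apply Continuous.intervalIntegrable; fun_prop),
      intervalIntegral.integral_const_mul, intervalIntegral.integral_const_mul,
      integral_cos_mul_cos, integral_sin_mul_cos]
    by_cases hk : k = j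
    · subst hk; simp
    · simp [hk]
  simp_rw [h]
  exact tsum_ite_eq j _

theorem integral_trigSeries_mul_sin {c d : ℕ → ℝ} (hc : Summable fun k => |c k|)
    (hd : Summable fun k => |d k|) (j : ℕ) :
    ∫ t in (-π)..π, trigSeries c d t * sin (j * t) = d j * (if j = 0 then 0 else π) := by
  rw [← (hasSum_integral_trigSeries_mul hc hd
    (φ := fun t => sin (j * t)) (by apply Continuous.intervalIntegrable; fun_prop)).tsum_eq]
  have h : ∀ k : ℕ, ∫ t in (-π)..π, (c k * cos (k * t) + d k * sin (k * t)) * sin (j * t) =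
      if k = j then d j * (if j = 0 then 0 else π) else 0 := fun k => by
    simp_rw [add_mul, mul_assoc, mul_comm (cos ((k : ℝ) * _))]
    rw [intervalIntegral.integral_add
      (by apply Continuous.intervalIntegrable; fun_prop)
      (by apply Continuous.intervalIntegrable; fun_prop),
      intervalIntegral.integral_const_mul, intervalIntegral.integral_const_mul,
      integral_sin_mul_sin, integral_sin_mul_cos]
    by_cases hk : k = j
    · subst hk; simp
    · simp [hk]
  simp_rw [h]
  exact tsum_ite_eq j _

theorem fourierSum_trigSeries {c d : ℕ → ℝ} (hc : Summable fun k => |c k|)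
    (hd : Summable fun k => |d k|) (m : ℕ) (x : ℝ) :
    fourierSum (trigSeries c d) m x =
      ∑ k ∈ Finset.range (m + 1), (c k * cos (k * x) + d k * sin (k * x)) := by
  have h0 : cosCoeff (trigSeries c d) 0 / 2 = c 0 := by
    unfold cosCoeff
    rw [integral_trigSeries_mul_cos hc hd]
    simp only [if_true]; field_simp
  rw [fourierSum, h0, Finset.sum_range_eq_add_Ico _ (Nat.succ_pos m)]
  congr 1
  · simp
  · refine Finset.sum_congr (by ext k; simp only [Finset.mem_Icc, Finset.mem_Ico]; omega) fun k hk => ?_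
    have hk0 : k ≠ 0 := by rintro rfl; simp at hk
    have e1 : cosCoeff (trigSeries c d) k = c k := by
      unfold cosCoeff; rw [integral_trigSeries_mul_cos hc hd, if_neg hk0]; field_simp
    have e2 : sinCoeff (trigSeries c d) k = d k := by
      unfold sinCoeff; rw [integral_trigSeries_mul_sin hc hd, if_neg hk0]; field_simp
    rw [e1, e2]

/-- Parseval: integrate the series termwise against itself and read off its coefficients. The
constant term would carry weight `2π` instead of `π`, hence the vanishing at index 0. -/
theorem integral_trigSeries_sq {c d : ℕ → ℝ} (hc : Summable fun k => |c k|)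
    (hd : Summable fun k => |d k|) (hc0 : c 0 = 0) (hd0 : d 0 = 0) :
    ∫ t in (-π)..π, trigSeries c d t ^ 2 = π * ∑' k, (c k ^ 2 + d k ^ 2) := by
  have hcont := continuous_trigSeries hc hd
  simp_rw [pow_two (trigSeries c d _)]
  rw [← (hasSum_integral_trigSeries_mul hc hd (φ := trigSeries c d)
    (hcont.intervalIntegrable _ _)).tsum_eq, ← tsum_mul_left]
  refine tsum_congr fun k => ?_
  have h : ∀ t : ℝ, (c k * cos (k * t) + d k * sin (k * t)) * trigSeries c d t =
      c k * (trigSeries c d t * cos (k * t)) + d k * (trigSeries c d t * sin (k * t)) :=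
    fun t => by ring
  simp_rw [h]
  rw [intervalIntegral.integral_add
    (by apply Continuous.intervalIntegrable; fun_prop)
    (by apply Continuous.intervalIntegrable; fun_prop),
    intervalIntegral.integral_const_mul, intervalIntegral.integral_const_mul,
    integral_trigSeries_mul_cos hc hd, integral_trigSeries_mul_sin hc hd]
  by_cases hk : k = 0
  · simp [hk, hc0, hd0]
  · simp only [if_neg hk]; ring

/-! ### Convolution with cosine kernels and with their tails. -/

theorem tsum_add_eq_of_eq_zero {g : ℕ → ℝ} {n : ℕ} (hg : ∀ k < n, g k = 0) :
    ∑' k, g (n + k) = ∑' k, g k := by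
  refine Function.Injective.tsum_eq (add_right_injective n) fun k hk => ?_
  have : n ≤ k := by
    by_contra h
    exact hk (hg k (by omega))
  exact ⟨k - n, Nat.add_sub_cancel' this⟩

/-- The kernel `∑_k w_k cos (k t - θ)`. -/
noncomputable def cosKernel (w : ℕ → ℝ) (θ t : ℝ) : ℝ := ∑' k : ℕ, w k * cos (k * t - θ)

section CosKernel

variable {w : ℕ → ℝ} (θ : ℝ)

theorem cosKernel_eq_trigSeries (w : ℕ → ℝ) (θ : ℝ) :
    cosKernel w θ = trigSeries (fun k => w k * cos θ) (fun k => w k * sin θ) := by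
  funext t
  refine tsum_congr fun k => ?_
  rw [cos_sub]; ring

theorem summable_abs_mul_of_abs_le {u v : ℕ → ℝ} {B : ℝ} (hu : Summable fun k => |u k|)
    (hv : ∀ k, |v k| ≤ B) : Summable fun k => |u k * v k| :=
  Summable.of_nonneg_of_le (fun _ => abs_nonneg _) (fun k => by
    rw [abs_mul]; exact mul_le_mul_of_nonneg_left (hv k) (abs_nonneg _)) (hu.mul_right B)

theorem continuous_cosKernel (hw : Summable fun k => |w k|) : Continuous (cosKernel w θ) := by
  rw [cosKernel_eq_trigSeries]
  exact continuous_trigSeries (summable_abs_mul_of_abs_le hw fun _ => le_rfl)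
    (summable_abs_mul_of_abs_le hw fun _ => le_rfl)

theorem periodic_cosKernel : Function.Periodic (cosKernel w θ) (2 * π) := fun t => by
  refine tsum_congr fun k => ?_
  rw [show (k : ℝ) * (t + 2 * π) - θ = (k * t - θ) + k * (2 * π) by ring, cos_add_nat_mul_two_pi]

theorem integral_comp_sub_left_of_periodic {f : ℝ → ℝ} (hf : Function.Periodic f (2 * π)) (x : ℝ) :
    ∫ t in (-π)..π, f (x - t) = ∫ t in (-π)..π, f t := by
  rw [intervalIntegral.integral_comp_sub_left]
  have h := hf.intervalIntegral_add_eq (x - π) (-π)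
  rw [show x - π + 2 * π = x - -π by ring, show -π + 2 * π = π by ring] at h
  exact h

theorem integral_cosKernel_comp_sub_sq (hw : Summable fun k => |w k|) (hw0 : w 0 = 0) (x : ℝ) :
    ∫ t in (-π)..π, cosKernel w θ (x - t) ^ 2 = π * ∑' k, w k ^ 2 := by
  have hp : Function.Periodic (fun t => cosKernel w θ t ^ 2) (2 * π) := fun t => by
    simp only [periodic_cosKernel θ t]
  rw [integral_comp_sub_left_of_periodic hp, cosKernel_eq_trigSeries, integral_trigSeries_sq
    (summable_abs_mul_of_abs_le hw fun _ => le_rfl)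
    (summable_abs_mul_of_abs_le hw fun _ => le_rfl) (by simp [hw0]) (by simp [hw0])]
  congr 1
  refine tsum_congr fun k => ?_
  rw [mul_pow, mul_pow, ← mul_add, cos_sq_add_sin_sq, mul_one]

theorem integral_cosKernel (hw : Summable fun k => |w k|) (hw0 : w 0 = 0) :
    ∫ t in (-π)..π, cosKernel w θ t = 0 := by
  have h := integral_trigSeries_mul_cos
    (summable_abs_mul_of_abs_le hw fun _ => le_refl |cos θ|)
    (summable_abs_mul_of_abs_le hw fun _ => le_refl |sin θ|) 0
  simpa [← cosKernel_eq_trigSeries, hw0] using h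

/-- Convolution with `cosKernel w θ` multiplies the Fourier coefficients by `w`. -/
theorem integral_cosKernel_mul (hw : Summable fun k => |w k|) {φ : ℝ → ℝ}
    (hφ : IntervalIntegrable φ volume (-π) π) (x : ℝ) :
    ∫ t in (-π)..π, cosKernel w θ (x - t) * φ t =
      trigSeries (fun k => w k * ∫ t in (-π)..π, cos (k * t + θ) * φ t)
        (fun k => w k * ∫ t in (-π)..π, sin (k * t + θ) * φ t) x := by
  have h := hasSum_intervalIntegral_mul (u := fun k t => w k * cos (k * (x - t) - θ))
    (b := fun k => |w k|) (φ := φ) (fun k => by fun_prop) (fun k t => by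
      rw [abs_mul]; exact mul_le_of_le_one_right (abs_nonneg _) (abs_cos_le_one _)) hw hφ
  unfold cosKernel
  rw [← h.tsum_eq]
  refine tsum_congr fun k => ?_
  have e : ∀ t : ℝ, w k * cos (k * (x - t) - θ) * φ t =
      w k * cos (k * x) * (cos (k * t + θ) * φ t) + w k * sin (k * x) * (sin (k * t + θ) * φ t) :=
    fun t => by
      rw [show (k : ℝ) * (x - t) - θ = k * x - (k * t + θ) by ring, cos_sub]; ring
  simp_rw [e]
  rw [intervalIntegral.integral_add
    ((hφ.continuousOn_mul (by fun_prop)).const_mul _)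
    ((hφ.continuousOn_mul (by fun_prop)).const_mul _),
    intervalIntegral.integral_const_mul, intervalIntegral.integral_const_mul]
  ring

/-- Bounds the Fourier coefficients of `φ` uniformly, so that their products with a summable `w`
stay summable. -/
theorem abs_integral_mul_le {u φ : ℝ → ℝ} (hu : ∀ t, |u t| ≤ 1)
    (hφ : IntervalIntegrable φ volume (-π) π) :
    |∫ t in (-π)..π, u t * φ t| ≤ ∫ t in (-π)..π, |φ t| := by
  have hpi : -π ≤ π := by linarith [pi_pos]
  rw [← Real.norm_eq_abs]
  refine intervalIntegral.norm_integral_le_of_norm_le (g := fun t => |φ t|) hpi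
    (Eventually.of_forall fun t _ => ?_) hφ.abs
  rw [norm_mul]
  exact mul_le_of_le_one_left (abs_nonneg _) (hu t)

/-- The deviation of a convolution with `cosKernel w θ` from its Fourier sum is the convolution
with the tail of the kernel. -/
theorem sub_fourierSum_eq (hw : Summable fun k => |w k|) {φ f : ℝ → ℝ}
    (hφ : IntervalIntegrable φ volume (-π) π) (hw0 : w 0 = 0) {a₀ : ℝ}
    (hf : ∀ x, f x = a₀ / 2 + 1 / π * ∫ t in (-π)..π, cosKernel w θ (x - t) * φ t) (m : ℕ) (x : ℝ) :
    f x - fourierSum f m x =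
      1 / π * ∫ t in (-π)..π, cosKernel (fun k => if m < k then w k else 0) θ (x - t) * φ t := by
  set p : ℕ → ℝ := fun k => ∫ t in (-π)..π, cos (k * t + θ) * φ t with hp
  set q : ℕ → ℝ := fun k => ∫ t in (-π)..π, sin (k * t + θ) * φ t with hq
  -- Since `w 0 = 0`, the convolution has no constant term, and index 0 is free to hold `a₀ / 2`.
  set c : ℕ → ℝ := fun k => if k = 0 then a₀ / 2 else 1 / π * (w k * p k) with hc
  set d : ℕ → ℝ := fun k => 1 / π * (w k * q k) with hd
  have hwp : Summable fun k => |w k * p k| :=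
    summable_abs_mul_of_abs_le hw fun k => abs_integral_mul_le (fun _ => abs_cos_le_one _) hφ
  have hwq : Summable fun k => |w k * q k| :=
    summable_abs_mul_of_abs_le hw fun k => abs_integral_mul_le (fun _ => abs_sin_le_one _) hφ
  have hds : Summable fun k => |d k| := by
    simp only [hd, abs_mul (1 / π)]; exact hwq.mul_left _
  have hcs : Summable fun k => |c k| := by
    refine (summable_nat_add_iff 1).1 ?_
    simp only [hc, Nat.succ_ne_zero, if_false, abs_mul (1 / π)]
    exact ((summable_nat_add_iff 1).2 hwp).mul_left _
  have hft : f = trigSeries c d := by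
    funext y
    rw [hf, integral_cosKernel_mul θ hw hφ, trigSeries, trigSeries,
      (summable_trigTerm hwp hwq y).tsum_eq_zero_add, (summable_trigTerm hcs hds y).tsum_eq_zero_add,
      mul_add, ← tsum_mul_left]
    simp only [hc, hd, hw0, Nat.succ_ne_zero, if_true, if_false, Nat.cast_zero, zero_mul, sin_zero,
      mul_zero, cos_zero, mul_one, add_zero, zero_add]
    congr 1
    refine tsum_congr fun k => ?_
    ring
  have hwt : Summable fun k => |if m < k then w k else 0| :=
    Summable.of_nonneg_of_le (fun _ => abs_nonneg _) (fun k => by split_ifs <;> simp) hw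
  rw [integral_cosKernel_mul θ hwt hφ, hft, fourierSum_trigSeries hcs hds]
  unfold trigSeries
  rw [← (summable_trigTerm hcs hds x).sum_add_tsum_nat_add (m + 1), add_sub_cancel_left,
    ← tsum_mul_left]
  refine Eq.trans ?_ (tsum_add_eq_of_eq_zero (n := m + 1) fun k hk => by
    simp [show ¬ m < k by omega])
  refine tsum_congr fun k => ?_
  rw [add_comm (m + 1) k]
  simp only [hc, hd, show k + (m + 1) ≠ 0 by omega, show m < k + (m + 1) by omega, if_true,
    if_false]
  ring

end CosKernel

/-! ### Asymptotics of the tail sum. -/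

/-- The leading term `exp (-a t ^ r) t ^ (1 - r) / (a r)` of `∑_{k ≥ t} exp (-a k ^ r)`. -/
noncomputable def tailMain (a r t : ℝ) : ℝ := exp (-a * t ^ r) * t ^ (1 - r) / (a * r)

theorem tailMain_nonneg {a r t : ℝ} (ha : 0 < a) (hr : 0 < r) (ht : 0 ≤ t) :
    0 ≤ tailMain a r t := by
  unfold tailMain; positivity

/-- Comparison with `1 / k ^ 2`: writing `k ^ 2 = (k ^ r) ^ (2 / r)` shows that `k ^ 2 * exp (-a k ^
r)` tends to 0. -/
theorem summable_exp_neg_mul_rpow {a r : ℝ} (ha : 0 < a) (hr : 0 < r) :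
    Summable fun k : ℕ => exp (-a * (k : ℝ) ^ r) := by
  have h1 : Tendsto (fun k : ℕ => ((k : ℝ) ^ r) ^ (2 / r) * exp (-a * (k : ℝ) ^ r)) atTop (𝓝 0) :=
    (tendsto_rpow_mul_exp_neg_mul_atTop_nhds_zero (2 / r) a ha).comp
      ((tendsto_rpow_atTop hr).comp tendsto_natCast_atTop_atTop)
  have hs : Summable fun k : ℕ => 1 / (k : ℝ) ^ (2 : ℕ) :=
    Real.summable_one_div_nat_pow.2 (by norm_num)
  refine summable_of_isBigO_nat hs (Asymptotics.IsBigO.of_bound 1 ?_)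
  filter_upwards [h1.eventually (ge_mem_nhds zero_lt_one), eventually_gt_atTop 0] with k hk hk0
  have hk0' : (0 : ℝ) < k := by exact_mod_cast hk0
  rw [← rpow_mul hk0'.le, mul_div_cancel₀ _ hr.ne', rpow_two] at hk
  rw [norm_of_nonneg (exp_pos _).le, norm_of_nonneg (by positivity), one_mul,
    le_div_iff₀ (by positivity)]
  linarith

theorem tendsto_tailMain {a r : ℝ} (ha : 0 < a) (hr : 0 < r) :
    Tendsto (tailMain a r) atTop (𝓝 0) := by
  have h1 := ((tendsto_rpow_mul_exp_neg_mul_atTop_nhds_zero ((1 - r) / r) a ha).comp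
      (tendsto_rpow_atTop hr)).div_const (a * r)
  rw [zero_div] at h1
  refine h1.congr' ?_
  filter_upwards [eventually_gt_atTop 0] with t ht
  simp only [Function.comp, tailMain]
  rw [← rpow_mul ht.le, mul_div_cancel₀ _ hr.ne', mul_comm]

theorem hasDerivAt_tailMain {a r t : ℝ} (ha : 0 < a) (hr : 0 < r) (ht : 0 < t) :
    HasDerivAt (tailMain a r)
      (exp (-a * t ^ r) * ((1 - r) / (a * r) * (1 / t ^ r) - 1)) t := by
  have h1 : HasDerivAt (fun t : ℝ => t ^ r) (r * t ^ (r - 1)) t :=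
    hasDerivAt_rpow_const (Or.inl ht.ne')
  have h2 : HasDerivAt (fun t : ℝ => t ^ (1 - r)) ((1 - r) * t ^ (1 - r - 1)) t :=
    hasDerivAt_rpow_const (Or.inl ht.ne')
  have h3 := (((h1.const_mul (-a)).exp).mul h2).div_const (a * r)
  refine h3.congr_deriv ?_
  have e1 : t ^ (r - 1) = t ^ r / t := rpow_sub_one ht.ne' r
  have e2 : t ^ (1 - r) = t / t ^ r := by rw [rpow_sub ht, rpow_one]
  have e3 : t ^ (1 - r - 1) = 1 / t ^ r := by
    rw [rpow_sub_one ht.ne', e2]; field_simp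
  have : 0 < t ^ r := by positivity
  rw [e3, e2, e1]
  field_simp
  ring

/-- By the mean value theorem the drop over `[t, t + 1]` is `exp (-a c ^ r)` times a factor in `[1 -
d, 1]`, and the exponential is decreasing. These are the two halves of the telescoping comparison.
-/
theorem tailMain_sub_bounds {a r : ℝ} (ha : 0 < a) (hr : 0 < r) (hr1 : r < 1) {t : ℝ}
    (ht : 0 < t) {d : ℝ} (hd : 1 / (a * r) * (1 / t ^ r) ≤ d) (hd1 : d ≤ 1) :
    tailMain a r t - tailMain a r (t + 1) ≤ exp (-a * t ^ r) ∧
      (1 - d) * exp (-a * (t + 1) ^ r) ≤ tailMain a r t - tailMain a r (t + 1) := by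
  have hder : ∀ x ∈ Set.Icc t (t + 1), HasDerivAt (tailMain a r)
      (exp (-a * x ^ r) * ((1 - r) / (a * r) * (1 / x ^ r) - 1)) x :=
    fun x hx => hasDerivAt_tailMain ha hr (ht.trans_le hx.1)
  obtain ⟨c, hc, h⟩ := exists_hasDerivAt_eq_slope (tailMain a r) _ (lt_add_one t)
    (fun x hx => (hder x hx).continuousAt.continuousWithinAt)
    (fun x hx => hder x (Set.Ioo_subset_Icc_self hx))
  have hc0 : 0 < c := ht.trans hc.1
  have e1 : exp (-a * c ^ r) ≤ exp (-a * t ^ r) := by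
    have : t ^ r ≤ c ^ r := rpow_le_rpow ht.le hc.1.le hr.le
    exact exp_le_exp.2 (by nlinarith)
  have e2 : exp (-a * (t + 1) ^ r) ≤ exp (-a * c ^ r) := by
    have : c ^ r ≤ (t + 1) ^ r := rpow_le_rpow hc0.le hc.2.le hr.le
    exact exp_le_exp.2 (by nlinarith)
  have e3 : 1 / c ^ r ≤ 1 / t ^ r := by
    have : t ^ r ≤ c ^ r := rpow_le_rpow ht.le hc.1.le hr.le
    gcongr
  have e4 : (1 - r) / (a * r) * (1 / c ^ r) ≤ d := by
    refine le_trans ?_ hd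
    have : 1 - r ≤ 1 := by linarith
    gcongr
  have e5 : 0 ≤ (1 - r) / (a * r) * (1 / c ^ r) := by
    have : 0 ≤ 1 - r := by linarith
    positivity
  have hp := exp_pos (-a * c ^ r)
  have hq := exp_pos (-a * (t + 1) ^ r)
  rw [add_sub_cancel_left, div_one] at h
  constructor <;> nlinarith

theorem tailMain_le_tsum {a r : ℝ} (ha : 0 < a) (hr : 0 < r) (hr1 : r < 1) {n : ℕ}
    (hn : 1 ≤ n) (hd1 : 1 / (a * r) * (1 / (n : ℝ) ^ r) ≤ 1) :
    tailMain a r n ≤ ∑' i : ℕ, exp (-a * ((n + i : ℕ) : ℝ) ^ r) := by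
  have hs : Summable fun i : ℕ => exp (-a * ((n + i : ℕ) : ℝ) ^ r) :=
    (summable_exp_neg_mul_rpow ha hr).comp_injective (add_right_injective n)
  have hn0 : (0 : ℝ) < n := by exact_mod_cast hn
  have key : ∀ m : ℕ, tailMain a r n - tailMain a r ((n + m : ℕ) : ℝ)
      ≤ ∑ i ∈ Finset.range m, exp (-a * ((n + i : ℕ) : ℝ) ^ r) := by
    intro m
    induction m with
    | zero => simp
    | succ m ih =>
      rw [Finset.sum_range_succ]
      have hle : (n : ℝ) ≤ ((n + m : ℕ) : ℝ) := by push_cast; linarith [Nat.cast_nonneg (α := ℝ) m]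
      have hrp : (n : ℝ) ^ r ≤ ((n + m : ℕ) : ℝ) ^ r := rpow_le_rpow hn0.le hle hr.le
      have := (tailMain_sub_bounds ha hr hr1 (hn0.trans_le hle) (le_trans (by gcongr) hd1) le_rfl).1
      rw [show ((n + (m + 1) : ℕ) : ℝ) = ((n + m : ℕ) : ℝ) + 1 by push_cast; ring]
      linarith
  have hl : Tendsto (fun m : ℕ => tailMain a r n - tailMain a r ((n + m : ℕ) : ℝ)) atTop
      (𝓝 (tailMain a r n - 0)) := by
    refine tendsto_const_nhds.sub ((tendsto_tailMain ha hr).comp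
      (tendsto_natCast_atTop_atTop.comp ?_))
    exact tendsto_atTop_mono (fun m => Nat.le_add_left m n) tendsto_id
  rw [sub_zero] at hl
  exact le_of_tendsto hl (Eventually.of_forall fun m =>
    (key m).trans (hs.sum_le_tsum _ fun i _ => (exp_pos _).le))

/-- A drop over `[t, t + 1]` controls only the term at `t + 1`, so the term at `n` is split off
before telescoping. -/
theorem tsum_le_tailMain {a r : ℝ} (ha : 0 < a) (hr : 0 < r) (hr1 : r < 1) {n : ℕ}
    (hn : 1 ≤ n) {d : ℝ} (hd : 1 / (a * r) * (1 / (n : ℝ) ^ r) ≤ d) (hd1 : d < 1) :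
    ∑' i : ℕ, exp (-a * ((n + i : ℕ) : ℝ) ^ r) ≤
      exp (-a * (n : ℝ) ^ r) + tailMain a r n / (1 - d) := by
  have hn0 : (0 : ℝ) < n := by exact_mod_cast hn
  have key : ∀ m : ℕ, ∑ i ∈ Finset.range (m + 1), exp (-a * ((n + i : ℕ) : ℝ) ^ r) ≤
      exp (-a * (n : ℝ) ^ r) + (tailMain a r n - tailMain a r ((n + m : ℕ) : ℝ)) / (1 - d) := by
    intro m
    induction m with
    | zero => simp
    | succ m ih =>
      rw [Finset.sum_range_succ]
      have hle : (n : ℝ) ≤ ((n + m : ℕ) : ℝ) := by push_cast; linarith [Nat.cast_nonneg (α := ℝ) m]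
      have hrp : (n : ℝ) ^ r ≤ ((n + m : ℕ) : ℝ) ^ r := rpow_le_rpow hn0.le hle hr.le
      have := (tailMain_sub_bounds ha hr hr1 (hn0.trans_le hle) (le_trans (by gcongr) hd) hd1.le).2
      rw [show ((n + (m + 1) : ℕ) : ℝ) = ((n + m : ℕ) : ℝ) + 1 by push_cast; ring]
      rw [mul_comm, ← le_div_iff₀ (by linarith)] at this
      calc _ ≤ _ := add_le_add ih this
        _ = _ := by ring
  refine Real.tsum_le_of_sum_range_le (fun _ => (exp_pos _).le) fun m => ?_
  refine le_trans ?_ ((key m).trans ?_)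
  · exact Finset.sum_le_sum_of_subset_of_nonneg (by simp) fun _ _ _ => (exp_pos _).le
  · have : 0 ≤ tailMain a r ((n + m : ℕ) : ℝ) := tailMain_nonneg ha hr (Nat.cast_nonneg _)
    gcongr
    linarith

/-- Two-sided estimate of the square root of `(1 / π) ∑_{k ≥ n} exp (-2 α k ^ r)`. -/
theorem exists_sqrt_tsum_eq {α r : ℝ} (hα : 0 < α) (hr : 0 < r) (hr1 : r < 1) {n : ℕ}
    (hn : 1 ≤ n) (hsmall : 1 / (α * r) * (1 / (n : ℝ) ^ r) + α * r * 2 / (n : ℝ) ^ (1 - r) ≤ 1 / 2) :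
    ∃ γ : ℝ, 0 ≤ γ ∧ γ ≤ 1 ∧
      √(1 / π * ∑' i : ℕ, exp (-(2 * α) * ((n + i : ℕ) : ℝ) ^ r)) =
        exp (-α * (n : ℝ) ^ r) / √(2 * π * α * r) * (n : ℝ) ^ ((1 - r) / 2) *
          (1 + γ * (1 / (α * r) * (1 / (n : ℝ) ^ r) + √(α * r) / (n : ℝ) ^ ((1 - r) / 2))) := by
  have hn0 : (0 : ℝ) < n := by exact_mod_cast hn
  set δ := 1 / (α * r) * (1 / (n : ℝ) ^ r) with hδ
  set s := √(α * r) / (n : ℝ) ^ ((1 - r) / 2) with hs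
  set S := ∑' i : ℕ, exp (-(2 * α) * ((n + i : ℕ) : ℝ) ^ r) with hS
  set M := exp (-α * (n : ℝ) ^ r) / √(2 * π * α * r) * (n : ℝ) ^ ((1 - r) / 2) with hM
  have hδ0 : 0 < δ := by positivity
  have hs0 : 0 < s := by positivity
  have hM0 : 0 < M := by positivity
  have hpow : ((n : ℝ) ^ ((1 - r) / 2)) ^ 2 = (n : ℝ) ^ (1 - r) := by
    rw [← rpow_natCast, ← rpow_mul hn0.le]; congr 1; push_cast; ring
  have hs2 : s ^ 2 = α * r / (n : ℝ) ^ (1 - r) := by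
    rw [hs, div_pow, hpow, sq_sqrt (by positivity)]
  have hexp : exp (-α * (n : ℝ) ^ r) ^ 2 = exp (-(2 * α) * (n : ℝ) ^ r) := by
    rw [← exp_nat_mul]; congr 1; push_cast; ring
  -- The claimed main term is the square root of `tailMain / π` taken at exponent `2 * α`.
  have hM2 : M ^ 2 = 1 / π * tailMain (2 * α) r n := by
    rw [hM, mul_pow, div_pow, hpow, sq_sqrt (by positivity), hexp, tailMain]
    field_simp
  have hsum : δ + 2 * s ^ 2 ≤ 1 / 2 := by
    rw [hs2]; refine le_trans (le_of_eq ?_) hsmall; ring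
  have hd : 1 / (2 * α * r) * (1 / (n : ℝ) ^ r) = δ / 2 := by rw [hδ]; field_simp
  have hlow := tailMain_le_tsum (a := 2 * α) (by positivity) hr hr1 hn (by rw [hd]; nlinarith)
  have hup := tsum_le_tailMain (a := 2 * α) (by positivity) hr hr1 hn hd.le (by nlinarith)
  rw [← hS] at hlow hup
  have hT0 : 0 ≤ tailMain (2 * α) r n := tailMain_nonneg (by positivity) hr hn0.le
  -- The split-off first term is of relative size `2 * s ^ 2`, which `hs1` absorbs into `s` because
  -- `s ≤ 1 / 2`.
  have hterm : exp (-(2 * α) * (n : ℝ) ^ r) = 2 * s ^ 2 * tailMain (2 * α) r n := by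
    rw [hs2, tailMain]; field_simp
  have hinv : tailMain (2 * α) r n / (1 - δ / 2) ≤ (1 + δ) * tailMain (2 * α) r n := by
    rw [div_le_iff₀ (by nlinarith)]
    have : 1 ≤ (1 + δ) * (1 - δ / 2) := by nlinarith
    nlinarith
  have hs1 : 2 * s ^ 2 ≤ s := by nlinarith
  have h1 : M ≤ √(1 / π * S) := by
    apply le_sqrt_of_sq_le
    rw [hM2]; gcongr
  have h2 : √(1 / π * S) ≤ M * (1 + (δ + s)) := by
    rw [sqrt_le_left (by positivity), mul_pow, hM2]
    have h3 : S ≤ tailMain (2 * α) r n * (1 + (δ + s)) := by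
      rw [hterm] at hup
      linarith [mul_le_mul_of_nonneg_right hs1 hT0]
    -- The crude loss `1 + x ≤ (1 + x) ^ 2` makes the square root immediate and still leaves `γ ≤
    -- 1`.
    have h4 : 1 + (δ + s) ≤ (1 + (δ + s)) ^ 2 := le_self_pow₀ (by linarith) two_ne_zero
    have h5 : S ≤ tailMain (2 * α) r n * (1 + (δ + s)) ^ 2 :=
      h3.trans (mul_le_mul_of_nonneg_left h4 hT0)
    calc _ ≤ 1 / π * (tailMain (2 * α) r n * (1 + (δ + s)) ^ 2) := by gcongr
      _ = _ := by ring
  -- The identity is solved for `γ`; then `h1` gives `0 ≤ γ` and `h2` gives `γ ≤ 1`.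
  refine ⟨(√(1 / π * S) - M) / (M * (δ + s)), ?_, ?_, ?_⟩
  · exact div_nonneg (by linarith) (by positivity)
  · rw [div_le_one (by positivity)]; linarith
  · field_simp
    ring

/-! ### The threshold, and duality on the unit ball of `L_2`. -/

/-- The inequality defining `n₀` is inherited by all larger integers. -/
theorem mem_thresholdSet_of_n₀_le {α r : ℝ} {p : ENNReal} (hα : 0 < α) (hr0 : 0 < r) (hr1 : r < 1)
    (hp : 1 ≤ p) {n : ℕ} (hn : n₀ α r p ≤ n) : n ∈ thresholdSet α r p := by
  obtain ⟨h1, h2⟩ := (isLeast_n₀ (α := α) hr0 hr1 hp).1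
  have h0 : (0 : ℝ) < n₀ α r p := by exact_mod_cast h1
  have hle : (n₀ α r p : ℝ) ≤ n := by exact_mod_cast hn
  refine ⟨h1.trans hn, le_trans ?_ h2⟩
  have hchi : 0 ≤ chi p := by unfold chi; split_ifs <;> positivity
  have e1 : (n₀ α r p : ℝ) ^ r ≤ (n : ℝ) ^ r := rpow_le_rpow h0.le hle hr0.le
  have e2 : (n₀ α r p : ℝ) ^ (1 - r) ≤ (n : ℝ) ^ (1 - r) :=
    rpow_le_rpow h0.le hle (by linarith)
  gcongr

theorem integral_sq_le_one_of_mem_unitBall {φ : ℝ → ℝ} (hφ : φ ∈ unitBall 2) :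
    ∫ t in Set.Ioc (-π) π, φ t ^ 2 ≤ 1 := by
  obtain ⟨-, h2, h3, -⟩ := hφ
  rw [h2.eLpNorm_eq_integral_rpow_norm two_ne_zero ENNReal.ofNat_ne_top, ENNReal.ofReal_le_one] at h3
  simp only [ENNReal.toReal_ofNat, rpow_two, norm_eq_abs, sq_abs] at h3
  have h0 : 0 ≤ ∫ t in Set.Ioc (-π) π, φ t ^ 2 := integral_nonneg fun t => sq_nonneg _
  by_contra! h
  exact absurd (one_lt_rpow h (by norm_num : (0 : ℝ) < 2⁻¹)) (not_lt.2 h3)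

theorem intervalIntegrable_of_mem_unitBall {φ : ℝ → ℝ} (hφ : φ ∈ unitBall 2) :
    IntervalIntegrable φ volume (-π) π :=
  (intervalIntegrable_iff_integrableOn_Ioc_of_le (by linarith [pi_pos])).2
    (hφ.2.1.integrable one_le_two)

/-- Cauchy–Schwarz through the pointwise inequality `|T φ| ≤ T² / (2N) + N φ² / 2`, whose right side
integrates to at most `N / 2 + N / 2`. -/
theorem abs_integral_mul_le_of_mem_unitBall {φ T : ℝ → ℝ} (hφ : φ ∈ unitBall 2)
    (hT : Continuous T) {N : ℝ} (hN : 0 < N) (hTN : ∫ t in (-π)..π, T t ^ 2 = N ^ 2) :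
    |∫ t in (-π)..π, T t * φ t| ≤ N := by
  have hpi : -π ≤ π := by linarith [pi_pos]
  have i1 : IntervalIntegrable (fun t => T t ^ 2) volume (-π) π :=
    (hT.pow 2).intervalIntegrable _ _
  have i2 : IntervalIntegrable (fun t => φ t ^ 2) volume (-π) π :=
    (intervalIntegrable_iff_integrableOn_Ioc_of_le hpi).2 hφ.2.1.integrable_sq
  have h1 : ∫ t in (-π)..π, φ t ^ 2 ≤ 1 := by
    rw [intervalIntegral.integral_of_le hpi]; exact integral_sq_le_one_of_mem_unitBall hφ
  have h2 : |∫ t in (-π)..π, T t * φ t| ≤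
      ∫ t in (-π)..π, (1 / (2 * N) * T t ^ 2 + N / 2 * φ t ^ 2) := by
    rw [← Real.norm_eq_abs]
    refine intervalIntegral.norm_integral_le_of_norm_le hpi
      (Eventually.of_forall fun t _ => ?_) ((i1.const_mul _).add (i2.const_mul _))
    rw [norm_eq_abs, abs_mul, ← sq_abs (T t), ← sq_abs (φ t), ← sub_nonneg]
    have : 1 / (2 * N) * |T t| ^ 2 + N / 2 * |φ t| ^ 2 - |T t| * |φ t| =
        (|T t| - N * |φ t|) ^ 2 / (2 * N) := by field_simp; ring
    rw [this]; positivity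
  rw [intervalIntegral.integral_add (i1.const_mul _) (i2.const_mul _),
    intervalIntegral.integral_const_mul, intervalIntegral.integral_const_mul, hTN] at h2
  have h3 : 1 / (2 * N) * N ^ 2 = N / 2 := by field_simp
  nlinarith

theorem mem_unitBall_of_continuous {φ : ℝ → ℝ} (hp : Function.Periodic φ (2 * π))
    (hc : Continuous φ) (h1 : ∫ t in (-π)..π, φ t ^ 2 = 1) (h0 : ∫ t in (-π)..π, φ t = 0) :
    φ ∈ unitBall 2 := by
  have hpi : -π ≤ π := by linarith [pi_pos]
  have hm : MemLp φ 2 (volume.restrict (Set.Ioc (-π) π)) :=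
    (memLp_two_iff_integrable_sq hc.aestronglyMeasurable).2
      ((intervalIntegrable_iff_integrableOn_Ioc_of_le hpi).1 ((hc.pow 2).intervalIntegrable _ _))
  refine ⟨hp, hm, ?_, h0⟩
  rw [intervalIntegral.integral_of_le hpi] at h1
  rw [hm.eLpNorm_eq_integral_rpow_norm two_ne_zero ENNReal.ofNat_ne_top]
  simp [h1]

/-! ### The exact value of the error and the conclusion. -/

/-- The multipliers `exp (-α k ^ r)`, cut off below `n`. -/
noncomputable def multiplier (α r : ℝ) (n k : ℕ) : ℝ := if n ≤ k then exp (-α * (k : ℝ) ^ r) else 0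

theorem summable_abs_multiplier {α r : ℝ} (hα : 0 < α) (hr : 0 < r) (n : ℕ) :
    Summable fun k => |multiplier α r n k| :=
  Summable.of_nonneg_of_le (fun _ => abs_nonneg _) (fun k => by
    unfold multiplier; split_ifs
    · rw [abs_of_pos (exp_pos _)]
    · rw [abs_zero]; exact (exp_pos _).le) (summable_exp_neg_mul_rpow hα hr)

theorem tsum_multiplier_sq (α r : ℝ) (n : ℕ) :
    ∑' k, multiplier α r n k ^ 2 = ∑' i : ℕ, exp (-(2 * α) * ((n + i : ℕ) : ℝ) ^ r) := by
  rw [← tsum_add_eq_of_eq_zero (n := n) fun k hk => by simp [multiplier, show ¬ n ≤ k by omega]]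
  refine tsum_congr fun i => ?_
  rw [multiplier, if_pos (Nat.le_add_right n i), ← exp_nat_mul]
  congr 1; push_cast; ring

theorem kernel_eq_cosKernel (α r β : ℝ) :
    kernel α r β = cosKernel (multiplier α r 1) (β * π / 2) := by
  funext t
  rw [kernel, cosKernel, ← tsum_add_eq_of_eq_zero (n := 1)
    (g := fun k => multiplier α r 1 k * cos (k * t - β * π / 2)) fun k hk => by
      simp [multiplier, show ¬ 1 ≤ k by omega]]
  refine tsum_congr fun k => ?_
  rw [multiplier, if_pos (Nat.le_add_right 1 k), add_comm 1 k]

/-- For `p = 2` the error of approximation by Fourier sums has a closed form. -/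
theorem fourierError_two_eq {α r : ℝ} (β : ℝ) (hα : 0 < α) (hr : 0 < r) {n : ℕ} (hn : 1 ≤ n) :
    fourierError α r β 2 n =
      ((√(1 / π * ∑' i : ℕ, exp (-(2 * α) * ((n + i : ℕ) : ℝ) ^ r)) : ℝ) : EReal) := by
  set θ := β * π / 2 with hθ
  set S := ∑' i : ℕ, exp (-(2 * α) * ((n + i : ℕ) : ℝ) ^ r) with hS
  set T := cosKernel (multiplier α r n) θ with hT
  have hw := summable_abs_multiplier hα hr n
  have hw0 : multiplier α r n 0 = 0 := by simp [multiplier, show n ≠ 0 by omega]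
  have hTc : Continuous T := continuous_cosKernel θ hw
  have hTp : Function.Periodic T (2 * π) := periodic_cosKernel θ
  have hSpos : 0 < S :=
    ((summable_exp_neg_mul_rpow (a := 2 * α) (by positivity) hr).comp_injective
      (add_right_injective n)).tsum_pos (fun _ => (exp_pos _).le) 0 (exp_pos _)
  set N := √(π * S) with hN
  have hN0 : 0 < N := sqrt_pos.2 (by positivity)
  have hN2 : N ^ 2 = π * S := sq_sqrt (by positivity)
  have hT2 : ∀ x, ∫ t in (-π)..π, T (x - t) ^ 2 = N ^ 2 := fun x => by
    rw [hT, integral_cosKernel_comp_sub_sq θ hw hw0, hN2, tsum_multiplier_sq]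
  have hval : √(1 / π * S) = 1 / π * N := by
    rw [hN, show 1 / π * S = (1 / π) ^ 2 * (π * S) by field_simp,
      sqrt_mul (by positivity), sqrt_sq (by positivity)]
  -- As `n ≥ 1`, the truncated subtraction is harmless: frequencies beyond `n - 1` are those from
  -- `n` on.
  have hcut : (fun k => if n - 1 < k then multiplier α r 1 k else 0) = multiplier α r n := by
    funext k
    unfold multiplier
    by_cases h : n ≤ k
    · rw [if_pos (by omega), if_pos (by omega), if_pos h]
    · rw [if_neg (by omega), if_neg h]
  have hdev : ∀ f φ : ℝ → ℝ, φ ∈ unitBall 2 → ∀ a₀ : ℝ,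
      (∀ x, f x = a₀ / 2 + 1 / π * ∫ t in (-π)..π, kernel α r β (x - t) * φ t) →
      ∀ x, f x - fourierSum f (n - 1) x = 1 / π * ∫ t in (-π)..π, T (x - t) * φ t := by
    intro f φ hφ a₀ hf x
    rw [kernel_eq_cosKernel] at hf
    rw [sub_fourierSum_eq θ (summable_abs_multiplier hα hr 1)
      (intervalIntegrable_of_mem_unitBall hφ) (by simp [multiplier]) hf, hcut]
  rw [hval]
  refine le_antisymm (iSup₂_le fun f hf => iSup_le fun x => ?_) ?_
  · obtain ⟨-, a₀, φ, hφ, hf⟩ := hf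
    beta_reduce
    rw [EReal.coe_le_coe_iff, hdev f φ hφ a₀ hf x, abs_mul, abs_of_pos (by positivity)]
    have := abs_integral_mul_le_of_mem_unitBall hφ (T := fun t => T (x - t)) (by fun_prop) hN0
      (hT2 x)
    gcongr
  -- The equality case of Cauchy–Schwarz at the point `x = 0`: `φ` is proportional to `t ↦ T (0 -
  -- t)`, with mean zero because `T` has no constant term.
  · set φ : ℝ → ℝ := fun t => T (0 - t) / N with hφd
    have hφ : φ ∈ unitBall 2 := by
      refine mem_unitBall_of_continuous (fun t => ?_) (by fun_prop) ?_ ?_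
      · simp only [hφd]
        rw [← hTp (0 - (t + 2 * π))]; congr 2; ring
      · simp_rw [hφd, div_pow]
        rw [intervalIntegral.integral_div, hT2, div_self (by positivity)]
      · simp_rw [hφd]
        rw [intervalIntegral.integral_div, integral_comp_sub_left_of_periodic hTp,
          integral_cosKernel θ hw hw0, zero_div]
    set f : ℝ → ℝ := fun x => 0 / 2 + 1 / π * ∫ t in (-π)..π, kernel α r β (x - t) * φ t with hfd
    have hf : f ∈ poissonClass α r β 2 := by
      refine ⟨fun x => ?_, 0, φ, hφ, fun x => rfl⟩
      simp only [hfd, kernel_eq_cosKernel]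
      congr 3
      funext t
      rw [show x + 2 * π - t = x - t + 2 * π by ring, periodic_cosKernel]
    have hd0 := hdev f φ hφ 0 (fun x => rfl) 0
    have hint : ∫ t in (-π)..π, T (0 - t) * φ t = N := by
      have e : ∀ t, T (0 - t) * φ t = T (0 - t) ^ 2 / N := fun t => by simp only [hφd]; ring
      simp_rw [e]
      rw [intervalIntegral.integral_div, hT2]
      field_simp
    rw [hint] at hd0
    refine le_trans ?_ (le_iSup₂_of_le f hf
      (le_iSup (fun x => ((|f x - fourierSum f (n - 1) x| : ℝ) : EReal)) 0))
    rw [hd0, EReal.coe_le_coe_iff]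
    exact le_abs_self _

end GenPoisson

theorem corollary1 (α r β : ℝ) (hα : 0 < α) (hr0 : 0 < r) (hr1 : r < 1)
    (n : ℕ) (hn : GenPoisson.n₀ α r 2 ≤ n) :
    ∃ γ : ℝ, |γ| ≤ 392 * Real.pi ^ ((5 : ℝ) / 2) ∧
      GenPoisson.fourierError α r β 2 n =
        ((Real.exp (-α * (n : ℝ) ^ r) / Real.sqrt (2 * Real.pi * α * r) *
            (n : ℝ) ^ ((1 - r) / 2) *
          (1 + γ * (1 / (α * r) * (1 / (n : ℝ) ^ r) +
            Real.sqrt (α * r) / (n : ℝ) ^ ((1 - r) / 2))) : ℝ) : EReal) := by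
  obtain ⟨h1, h2⟩ := GenPoisson.mem_thresholdSet_of_n₀_le hα hr0 hr1 one_le_two hn
  have hchi : GenPoisson.chi 2 = 2 := by simp [GenPoisson.chi]
  -- The estimate of the tail needs only the weak bound `1 / 2`.
  have hbound : GenPoisson.thresholdBound 2 ≤ 1 / 2 := by
    have h3 : (1 : ℝ) ≤ (3 * Real.pi) ^ 3 := one_le_pow₀ (by linarith [Real.pi_gt_three])
    have h4 : 1 / (3 * Real.pi) ^ 3 ≤ 1 := (div_le_one (by positivity)).2 h3
    simp only [GenPoisson.thresholdBound, OfNat.ofNat_ne_one, ENNReal.ofNat_ne_top, if_false,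
      ENNReal.toReal_ofNat]
    linarith
  rw [hchi] at h2
  obtain ⟨γ, hγ0, hγ1, h⟩ := GenPoisson.exists_sqrt_tsum_eq hα hr0 hr1 h1 (h2.trans hbound)
  refine ⟨γ, ?_, ?_⟩
  · rw [abs_of_nonneg hγ0]
    have : 1 ≤ Real.pi ^ ((5 : ℝ) / 2) :=
      Real.one_le_rpow (by linarith [Real.pi_gt_three]) (by norm_num)
    linarith
  · rw [GenPoisson.fourierError_two_eq β hα hr0 h1, h]
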